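/- Let $\mathcal S$ be a set (of sorts), and let $\omega\text{-}\mathsf{CPO}$ be the cartesian closed category of $\omega$-cpos (posets in which every $\omega$-chain has a supremum) and $\omega$-continuous functions (monotone functions preserving suprema of $\omega$-chains); its internal hom $[X,Y]$ is the set of $\omega$-continuous functions $X\to Y$ with the pointwise order. Let $\omega\text{-}\mathsf{CPO}^{\mathcal S}$ be the $(\omega\text{-}\mathsf{CPO})$-category of $\mathcal S$-indexed families of $\omega$-cpos, with hom-objects $\prod_{S}[X_S,Y_S]$. For $J:\mathcal S\to\mathbb N$ of finite support write $A^J=\prod_S A_S^{J(S)}$. An $(\omega\text{-}\mathsf{CPO})$-enriched $\mathcal S$-sorted signature $\Sigma$ is a set of operation symbols $\sigma$, each with a type $(J,S,P)$, where $J:\mathcal S\to\mathbb N$ has finite support, $S\in\mathcal S$, and $P$ is an $\omega$-cpo (the parameter object). A $\Sigma$-algebra is a family $A=(A_S)_{S\in\mathcal S}$ of $\omega$-cpos with an $\omega$-continuous map $\sigma^A:P\to[A^J,A_S]$ for each $\sigma$ of type $(J,S,P)$; the $(\omega\text{-}\mathsf{CPO})$-category $\Sigma\text{-}\mathsf{Alg}$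 has as hom-object from $A$ to $B$ the sub-$\omega$-cpo of $\prod_S[A_S,B_S]$ consisting of the families $f$ that commute with all the operations. The signature is classical if every parameter object is the one-point $\omega$-cpo. The underlying classical signature $|\Sigma|$ has an operation symbol $\sigma_p$ with input sorts $J$ and output sort $S$ for each $\sigma$ of type $(J,S,P)$ and each $p\in P$; each $\Sigma$-algebra $A$ has an underlying $|\Sigma|$-algebra $|A|$ with $\sigma_p^{|A|}=\sigma^A(p)$. For a classical signature $\Sigma$, a context $\vec v$ is a finite set of sorted variables $v_1:S_1,\dots,v_n:S_n$, and each $\Sigma$-term $t$ of sort $S$ in context $\vec v$ is interpreted in a $\Sigma$-algebra $A$ as an $\omega$-continuous map $t^A:A_{S_1}\times\dots\times A_{S_n}\to A_S$ in the usual way. A $\Sigma$-algebra $A$ satisfies a syntactic equation $[\vec v\vdash s\doteq t:S]$ if $s^A=t^A$, and it satisfies an $(\omega\text{-}\mathsf{CPO})$-relation $[\vec v\vdash\bigvee_{n\ge0}t_n\doteq t:S]$ (where $t_n$ $(n\ge 0)$ and $t$ are terms of sort $S$ in context $\vec v$) if $t_n^A\le t_{n+1}^A$ for all $n\ge 0$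 and $\bigvee_{n\ge0}t_n^A=t^A$ in the $\omega$-cpo $[A_{S_1}\times\dots\times A_{S_n},A_S]$. An $(\omega\text{-}\mathsf{CPO})$-enriched $\mathcal S$-sorted equational theory $\mathcal T=(\Sigma,\mathcal E)$ consists of an $(\omega\text{-}\mathsf{CPO})$-enriched signature $\Sigma$ and a set $\mathcal E$ of syntactic $|\Sigma|$-equations; a $\mathcal T$-algebra is a $\Sigma$-algebra $A$ such that $|A|$ satisfies all the equations in $\mathcal E$. A classical $\mathcal S$-sorted equational theory with $(\omega\text{-}\mathsf{CPO})$-relations $\mathcal P=(\Sigma,\mathcal R,\mathcal E)$ consists of a classical signature $\Sigma$, a set $\mathcal R$ of $(\omega\text{-}\mathsf{CPO})$-relations, and a set $\mathcal E$ of syntactic $\Sigma$-equations; a $\mathcal P$-algebra is a $\Sigma$-algebra satisfying all of them. $\mathcal T\text{-}\mathsf{Alg}$ and $\mathcal P\text{-}\mathsf{Alg}$ are the corresponding full sub-$(\omega\text{-}\mathsf{CPO})$-categories of $\Sigma\text{-}\mathsf{Alg}$, equipped with the forgetful $(\omega\text{-}\mathsf{CPO})$-functors to $\omega\text{-}\mathsf{CPO}^{\mathcal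 S}$. **Proposition.** For every classical $\mathcal S$-sorted equational theory with $(\omega\text{-}\mathsf{CPO})$-relations $\mathcal P$ there is an $(\omega\text{-}\mathsf{CPO})$-enriched $\mathcal S$-sorted equational theory $\mathcal T_{\mathcal P}$ such that $\mathcal P\text{-}\mathsf{Alg}\cong\mathcal T_{\mathcal P}\text{-}\mathsf{Alg}$ in the slice category $(\omega\text{-}\mathsf{CPO})\text{-}\mathsf{CAT}/\omega\text{-}\mathsf{CPO}^{\mathcal S}$; that is, there are mutually inverse $(\omega\text{-}\mathsf{CPO})$-functors between $\mathcal P\text{-}\mathsf{Alg}$ and $\mathcal T_{\mathcal P}\text{-}\mathsf{Alg}$ that commute strictly with the forgetful $(\omega\text{-}\mathsf{CPO})$-functors to $\omega\text{-}\mathsf{CPO}^{\mathcal S}$. -/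

import Mathlib

open CategoryTheory MonoidalCategory OmegaCompletePartialOrder

universe u v w u₁ u₂ u₃

noncomputable section

/-! ### Continuity lemmas -/

/-- Continuity into the internal hom can be checked pointwise. -/
theorem ωScottContinuous_of_pointwise {α β γ : Type*} [OmegaCompletePartialOrder α]
    [OmegaCompletePartialOrder β] [OmegaCompletePartialOrder γ] {f : α → β →𝒄 γ}
    (h : ∀ b, ωScottContinuous fun a => f a b) : ωScottContinuous f := by
  refine ωScottContinuous.of_monotone_map_ωSup
    ⟨fun x y hxy b => (h b).monotone hxy, fun c => ContinuousHom.ext _ _ fun b => ?_⟩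
  exact (h b).map_ωSup c

/-- Evaluating a continuous map at a fixed point is continuous. -/
theorem ωScottContinuous_eval {β γ : Type*} [OmegaCompletePartialOrder β]
    [OmegaCompletePartialOrder γ] (b : β) : ωScottContinuous fun f : β →𝒄 γ => f b :=
  ContinuousHom.ωScottContinuous_apply ωScottContinuous.id ωScottContinuous.const

/-- Composition of two continuous maps is jointly continuous. -/
theorem ωScottContinuous_comp {α β γ : Type*} [OmegaCompletePartialOrder α]
    [OmegaCompletePartialOrder β] [OmegaCompletePartialOrder γ] :
    ωScottContinuous fun p : (α →𝒄 β) × (β →𝒄 γ) => p.2.comp p.1 :=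
  ωScottContinuous_of_pointwise fun a => ContinuousHom.ωScottContinuous_apply
    _root_.Prod.ωScottContinuous_snd
    ((ωScottContinuous_eval a).comp _root_.Prod.ωScottContinuous_fst)

/-- Composition of two families of continuous maps is jointly continuous. -/
theorem ωScottContinuous_familyComp {S : Type*} {X Y Z : S → Type*}
    [∀ s, OmegaCompletePartialOrder (X s)] [∀ s, OmegaCompletePartialOrder (Y s)]
    [∀ s, OmegaCompletePartialOrder (Z s)] :
    ωScottContinuous fun (p : (∀ s, X s →𝒄 Y s) × (∀ s, Y s →𝒄 Z s)) (s : S) =>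
      (p.2 s).comp (p.1 s) :=
  ωScottContinuous.of_apply₂ fun s => (ωScottContinuous_comp (α := X s) (β := Y s) (γ := Z s)).comp
    (f := fun p : (∀ s, X s →𝒄 Y s) × (∀ s, Y s →𝒄 Z s) => (p.1 s, p.2 s))
    (_root_.Prod.ωScottContinuous.prodMk
      ((ωScottContinuous.apply s).comp _root_.Prod.ωScottContinuous_fst)
      ((ωScottContinuous.apply s).comp _root_.Prod.ωScottContinuous_snd))

/-! ### The cartesian monoidal category of ω-cpos -/

namespace ωCPO

/-- The one-point ω-cpo is terminal. -/
def terminalCone : Limits.LimitCone (Functor.empty.{0} ωCPO.{u}) where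
  cone := Limits.asEmptyCone (ωCPO.of PUnit.{u + 1})
  isLimit := Limits.IsTerminal.ofUniqueHom
    (fun X => (ContinuousHom.const PUnit.unit : X →𝒄 PUnit.{u + 1})) (fun _ _ => rfl)

/-- The product of sets with the componentwise order is the binary product of ω-cpos. -/
def productCone (X Y : ωCPO.{u}) : Limits.LimitCone (Limits.pair X Y) where
  cone := Limits.BinaryFan.mk (P := ωCPO.of (X × Y))
    (ContinuousHom.ofFun Prod.fst : (X × Y) →𝒄 X)
    (ContinuousHom.ofFun Prod.snd : (X × Y) →𝒄 Y)
  isLimit := Limits.BinaryFan.IsLimit.mk _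
    (fun {T} (f : T →𝒄 X) (g : T →𝒄 Y) =>
      (ContinuousHom.ofFun (fun t => (f t, g t))
        (_root_.Prod.ωScottContinuous.prodMk f.ωScottContinuous g.ωScottContinuous) : T →𝒄 (X × Y)))
    (fun _ _ => rfl) (fun _ _ => rfl)
    (by
      rintro T f g m rfl rfl
      rfl)

instance : CartesianMonoidalCategory ωCPO.{u} :=
  .ofChosenFiniteProducts terminalCone productCone

end ωCPO

/-! ### Enriched categories over a fixed enriched category -/

section Enriched

variable (V : Type v) [Category.{w} V] [MonoidalCategory V]

/-- The objects of the full sub-`V`-category of `C` on the objects satisfying `p`. -/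
structure FullSub {C : Type u₁} (p : C → Prop) where
  obj : C
  property : p obj

instance {C : Type u₁} [EnrichedCategory V C] (p : C → Prop) :
    EnrichedCategory V (FullSub p) where
  Hom X Y := X.obj ⟶[V] Y.obj
  id X := eId V X.obj
  comp X Y Z := eComp V X.obj Y.obj Z.obj
  id_comp X Y := EnrichedCategory.id_comp X.obj Y.obj
  comp_id X Y := EnrichedCategory.comp_id X.obj Y.obj
  assoc W X Y Z := EnrichedCategory.assoc W.obj X.obj Y.obj Z.obj

/-- The inclusion `V`-functor of a full sub-`V`-category. -/
def FullSub.incl {C : Type u₁} [EnrichedCategory V C] (p : C → Prop) :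
    EnrichedFunctor V (FullSub p) C where
  obj X := X.obj
  map X Y := 𝟙 (X.obj ⟶[V] Y.obj)
  map_id X := Category.comp_id _
  map_comp X Y Z := by
    refine (Category.comp_id _).trans ?_
    exact ((congrArg (· ≫ eComp V X.obj Y.obj Z.obj)
      (id_tensorHom_id (X.obj ⟶[V] Y.obj) (Y.obj ⟶[V] Z.obj))).trans (Category.id_comp _)).symm

/-- `(C, U)` and `(D, W)` are isomorphic in the slice category `V-CAT / E`: there are mutually
inverse `V`-functors between `C` and `D` that commute (strictly) with `U` and `W`. -/
def IsoOver {C : Type u₁} {D : Type u₂} {E : Type u₃} [EnrichedCategory V C]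
    [EnrichedCategory V D] [EnrichedCategory V E]
    (U : EnrichedFunctor V C E) (W : EnrichedFunctor V D E) : Prop :=
  ∃ (F : EnrichedFunctor V C D) (G : EnrichedFunctor V D C),
    F.comp V G = EnrichedFunctor.id V C ∧ G.comp V F = EnrichedFunctor.id V D ∧
    F.comp V W = U ∧ G.comp V U = W

end Enriched

/-! ### The enriched category of families of ω-cpos -/

/-- The objects of `ωCPO ^ S`. -/
abbrev Family (S : Type u) : Type (u + 1) := S → ωCPO.{u}

/-- Hom-objects are the products `∏ s, [X s, Y s]`, where the internal hom `[X s, Y s]` consists of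
the ω-continuous functions with the pointwise order. -/
instance (S : Type u) : EnrichedCategory ωCPO.{u} (Family S) where
  Hom X Y := ωCPO.of (∀ s, X s →𝒄 Y s)
  id X := (ContinuousHom.const (fun _ => ContinuousHom.id) : PUnit.{u + 1} →𝒄 (∀ s, X s →𝒄 X s))
  comp X Y Z := (ContinuousHom.ofFun (fun p s => (p.2 s).comp (p.1 s))
    ωScottContinuous_familyComp :
    ((∀ s, X s →𝒄 Y s) × (∀ s, Y s →𝒄 Z s)) →𝒄 (∀ s, X s →𝒄 Z s))
  id_comp _ _ := rfl
  comp_id _ _ := rfl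
  assoc _ _ _ _ := rfl

namespace Family

variable {S : Type u}

/-- The power `X ^ J = ∏ s, (X s) ^ (J s)`. -/
abbrev Pow (X : Family S) (J : S →₀ ℕ) : Type u := ∀ s, Fin (J s) → X s

/-- The map `f ^ J : X ^ J → Y ^ J`. -/
def powMap {X Y : Family S} (f : ∀ s, X s →𝒄 Y s) (J : S →₀ ℕ) (x : X.Pow J) : Y.Pow J :=
  fun s i => f s (x s i)

end Family

/-! ### Enriched signatures and their algebras -/

/-- An (ω-CPO)-enriched `S`-sorted signature. -/
structure EnrichedSignature (S : Type u) where
  Op : Type u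
  input : Op → (S →₀ ℕ)
  output : Op → S
  param : Op → ωCPO.{u}

namespace EnrichedSignature

variable {S : Type u}

/-- A `Sig`-algebra: a family of ω-cpos with ω-continuous maps `P → [A ^ J, A s]` for each
operation symbol of type `(J, s, P)`. -/
structure Algebra (Sig : EnrichedSignature S) where
  carrier : Family S
  op : ∀ σ : Sig.Op, Sig.param σ →𝒄 (carrier.Pow (Sig.input σ) →𝒄 carrier (Sig.output σ))

variable {Sig : EnrichedSignature S}

/-- A morphism of `ωCPO ^ S` is a morphism of `Sig`-algebras if it commutes with all operations. -/
def IsHom (A B : Sig.Algebra) (f : ∀ s, A.carrier s →𝒄 B.carrier s) : Prop :=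
  ∀ (σ : Sig.Op) (p : Sig.param σ) (x : A.carrier.Pow (Sig.input σ)),
    f (Sig.output σ) (A.op σ p x) = B.op σ p (Family.powMap f (Sig.input σ) x)

theorem isHom_ωSup (A B : Sig.Algebra) (c : Chain (∀ s, A.carrier s →𝒄 B.carrier s))
    (hc : ∀ f ∈ c, IsHom A B f) : IsHom A B (ωSup c) := by
  intro σ p x
  have hev : ∀ s (y : A.carrier s), ωScottContinuous
      fun f : ∀ s, A.carrier s →𝒄 B.carrier s => f s y := fun s y =>
    (ωScottContinuous_eval y).comp (ωScottContinuous.apply s)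
  have hpow : ωScottContinuous fun f : ∀ s, A.carrier s →𝒄 B.carrier s =>
      Family.powMap f (Sig.input σ) x :=
    ωScottContinuous.of_apply₂ fun s => ωScottContinuous.of_apply₂ fun i => hev s (x s i)
  have hl := (hev (Sig.output σ) (A.op σ p x)).map_ωSup c
  have hr := ((B.op σ p).ωScottContinuous.comp hpow).map_ωSup c
  refine hl.trans (Eq.trans ?_ hr.symm)
  congr 1
  ext n
  exact hc (c n) ⟨n, rfl⟩ σ p x

theorem isHom_comp {A B C : Sig.Algebra} {f : ∀ s, A.carrier s →𝒄 B.carrier s}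
    {g : ∀ s, B.carrier s →𝒄 C.carrier s} (hf : IsHom A B f) (hg : IsHom B C g) :
    IsHom A C fun s => (g s).comp (f s) := fun σ p x =>
  (congrArg (g (Sig.output σ)) (hf σ p x)).trans (hg σ p _)

/-- The hom-object of algebras: the equalizer, as a sub-ω-cpo of `∏ s, [A s, B s]`. -/
instance (A B : Sig.Algebra) : OmegaCompletePartialOrder {f // IsHom A B f} :=
  OmegaCompletePartialOrder.subtype _ (isHom_ωSup A B)

theorem ωScottContinuous_val (A B : Sig.Algebra) :
    ωScottContinuous (Subtype.val : {f // IsHom A B f} → ∀ s, A.carrier s →𝒄 B.carrier s) :=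
  .of_monotone_map_ωSup ⟨fun _ _ h => h, fun _ => rfl⟩

theorem ωScottContinuous_homComp (A B C : Sig.Algebra) :
    ωScottContinuous fun p : {f // IsHom A B f} × {g // IsHom B C g} =>
      (⟨fun s => (p.2.1 s).comp (p.1.1 s), isHom_comp p.1.2 p.2.2⟩ : {h // IsHom A C h}) := by
  have h : ωScottContinuous fun p : {f // IsHom A B f} × {g // IsHom B C g} =>
      fun s => (p.2.1 s).comp (p.1.1 s) :=
    ωScottContinuous_familyComp.comp (_root_.Prod.ωScottContinuous.prodMk
      ((ωScottContinuous_val A B).comp _root_.Prod.ωScottContinuous_fst)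
      ((ωScottContinuous_val B C).comp _root_.Prod.ωScottContinuous_snd))
  exact .of_monotone_map_ωSup ⟨fun _ _ hpq => h.monotone hpq,
    fun c => Subtype.ext (h.map_ωSup c)⟩

instance : EnrichedCategory ωCPO.{u} Sig.Algebra where
  Hom A B := ωCPO.of {f // IsHom A B f}
  id A := (ContinuousHom.const ⟨fun _ => ContinuousHom.id, fun _ _ _ => rfl⟩ :
    PUnit.{u + 1} →𝒄 {f // IsHom A A f})
  comp A B C := (ContinuousHom.ofFun
    (fun p => ⟨fun s => (p.2.1 s).comp (p.1.1 s), isHom_comp p.1.2 p.2.2⟩)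
    (ωScottContinuous_homComp A B C) :
    ({f // IsHom A B f} × {g // IsHom B C g}) →𝒄 {h // IsHom A C h})
  id_comp _ _ := rfl
  comp_id _ _ := rfl
  assoc _ _ _ _ := rfl

/-- The forgetful enriched functor from `Sig`-algebras to `ωCPO ^ S`. -/
def Algebra.forget (Sig : EnrichedSignature S) :
    EnrichedFunctor ωCPO.{u} Sig.Algebra (Family S) where
  obj A := A.carrier
  map A B := (ContinuousHom.ofFun Subtype.val (ωScottContinuous_val A B) :
    {f // IsHom A B f} →𝒄 (∀ s, A.carrier s →𝒄 B.carrier s))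
  map_id _ := rfl
  map_comp _ _ _ := rfl

end EnrichedSignature

/-! ### Classical signatures, terms and their interpretations -/

/-- A classical `S`-sorted signature (all parameter objects are trivial). -/
structure ClassicalSignature (S : Type u) where
  Op : Type u
  input : Op → (S →₀ ℕ)
  output : Op → S

/-- A classical signature as an enriched signature: every operation symbol has the terminal
ω-cpo as its parameter object. -/
def ClassicalSignature.toEnriched {S : Type u} (Sig : ClassicalSignature S) :
    EnrichedSignature S where
  Op := Sig.Op
  input := Sig.input
  output := Sig.output
  param _ := 𝟙_ ωCPO.{u}

/-- A variable context: a finite set of sorted variables. The variable symbols of sort `s` are the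
pairs `(s, n)` with `n : ℕ`, so they form pairwise disjoint countably infinite sets. -/
abbrev Context (S : Type u) : Type u := Finset (S × ℕ)

/-- The product `A_{s₁} × ⋯ × A_{sₙ}` over the variables of a context. -/
abbrev Family.Env {S : Type u} (X : Family S) (c : Context S) : Type u :=
  ∀ x : {x // x ∈ c}, X x.1.1

namespace ClassicalSignature

variable {S : Type u}

/-- Terms in context, indexed by their sort. -/
inductive Term (Sig : ClassicalSignature S) (c : Context S) : S → Type u
  | var (s : S) (n : ℕ) (h : (s, n) ∈ c) : Term Sig c s
  | op (σ : Sig.Op) (t : ∀ s, Fin (Sig.input σ s) → Term Sig c s) : Term Sig c (Sig.output σ)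

/-- The algebras of a classical signature. -/
abbrev Algebra (Sig : ClassicalSignature S) : Type (u + 1) := Sig.toEnriched.Algebra

variable {Sig : ClassicalSignature S}

/-- The map `σ^A : A ^ J → A_s` interpreting an ordinary operation symbol. -/
def Algebra.ordOp (A : Sig.Algebra) (σ : Sig.Op) :
    A.carrier.Pow (Sig.input σ) →𝒄 A.carrier (Sig.output σ) :=
  A.op σ PUnit.unit

/-- The interpretation `t^A` of a term in context. -/
def Term.interp (A : Sig.Algebra) {c : Context S} :
    {s : S} → Sig.Term c s → (A.carrier.Env c →𝒄 A.carrier s)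
  | _, .var s n h => ContinuousHom.ofFun (fun e => e ⟨(s, n), h⟩)
      (ωScottContinuous.apply (β := fun x : {x // x ∈ c} => A.carrier x.1.1) ⟨(s, n), h⟩)
  | _, .op σ t => (Algebra.ordOp A σ).comp
      (ContinuousHom.ofFun (fun e s i => (t s i).interp A e)
        (ωScottContinuous.of_apply₂ fun s => ωScottContinuous.of_apply₂ fun i =>
          ((t s i).interp A).ωScottContinuous))

/-- A syntactic equation in context `[c ⊢ lhs ≐ rhs : sort]`. -/
structure Equation (Sig : ClassicalSignature S) where
  ctx : Context S
  sort : S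
  lhs : Sig.Term ctx sort
  rhs : Sig.Term ctx sort

/-- Satisfaction of a syntactic equation. -/
def Equation.Sat (e : Sig.Equation) (A : Sig.Algebra) : Prop :=
  e.lhs.interp A = e.rhs.interp A

/-- An (ω-CPO)-relation in context `[c ⊢ ⋁ n, seq n ≐ sup : sort]`. -/
structure Relation (Sig : ClassicalSignature S) where
  ctx : Context S
  sort : S
  seq : ℕ → Sig.Term ctx sort
  sup : Sig.Term ctx sort

/-- Satisfaction of an (ω-CPO)-relation: in the ω-cpo of ω-continuous maps from the product over
the context to the carrier, the interpretations of the terms `seq n` form an ω-chain, whose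
supremum is the interpretation of `sup`. -/
def Relation.Sat (r : Sig.Relation) (A : Sig.Algebra) : Prop :=
  ∃ h : ∀ n, (r.seq n).interp A ≤ (r.seq (n + 1)).interp A,
    ωSup (⟨⟨fun n => (r.seq n).interp A, monotone_nat_of_le_succ h⟩⟩ :
      Chain (A.carrier.Env r.ctx →𝒄 A.carrier r.sort)) = r.sup.interp A

end ClassicalSignature

/-! ### The underlying classical signature of an enriched signature -/

namespace EnrichedSignature

variable {S : Type u}

/-- The classical signature with an operation symbol `σ_p` for each operation symbol `σ` and each
element `p` of its parameter object. -/
def underlying (Sig : EnrichedSignature S) : ClassicalSignature S where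
  Op := Σ σ : Sig.Op, Sig.param σ
  input σ := Sig.input σ.1
  output σ := Sig.output σ.1

/-- The underlying algebra `|A|`, with `σ_p` interpreted by `σ^A(p)`. -/
def Algebra.underlying {Sig : EnrichedSignature S} (A : Sig.Algebra) : Sig.underlying.Algebra where
  carrier := A.carrier
  op σ := (ContinuousHom.const (A.op σ.1 σ.2) : PUnit.{u + 1} →𝒄 _)

end EnrichedSignature

/-! ### Theories and their algebras -/

/-- An (ω-CPO)-enriched `S`-sorted equational theory. -/
structure EnrichedTheory (S : Type u) where
  sig : EnrichedSignature S
  eqns : Set sig.underlying.Equation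

namespace EnrichedTheory

variable {S : Type u} (T : EnrichedTheory S)

/-- The `T`-algebras among the algebras of the signature of `T`. -/
def IsAlgebra (A : T.sig.Algebra) : Prop :=
  ∀ e ∈ T.eqns, e.Sat A.underlying

/-- The objects of the enriched category of `T`-algebras. -/
abbrev Alg : Type (u + 1) := FullSub T.IsAlgebra

/-- The forgetful enriched functor on `T`-algebras. -/
def forget : EnrichedFunctor ωCPO.{u} T.Alg (Family S) :=
  (FullSub.incl ωCPO.{u} T.IsAlgebra).comp ωCPO.{u} (EnrichedSignature.Algebra.forget T.sig)

end EnrichedTheory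

/-- A classical `S`-sorted equational theory with (ω-CPO)-relations. -/
structure ClassicalTheoryWithRelations (S : Type u) where
  sig : ClassicalSignature S
  rels : Set sig.Relation
  eqns : Set sig.Equation

namespace ClassicalTheoryWithRelations

variable {S : Type u} (P : ClassicalTheoryWithRelations S)

/-- The `P`-algebras among the algebras of the signature of `P`. -/
def IsAlgebra (A : P.sig.Algebra) : Prop :=
  (∀ r ∈ P.rels, r.Sat A) ∧ ∀ e ∈ P.eqns, e.Sat A

/-- The objects of the enriched category of `P`-algebras. -/
abbrev Alg : Type (u + 1) := FullSub P.IsAlgebra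

/-- The forgetful enriched functor on `P`-algebras. -/
def forget : EnrichedFunctor ωCPO.{u} P.Alg (Family S) :=
  (FullSub.incl ωCPO.{u} P.IsAlgebra).comp ωCPO.{u}
    (EnrichedSignature.Algebra.forget P.sig.toEnriched)

end ClassicalTheoryWithRelations

end

/-! An ω-chain together with its supremum in an ω-cpo `X` is the same thing as an ω-continuous map
`ℕ∞ → X` (`ωScottContinuous_enat_iff`). Applied to the internal hom, this says that an algebra
satisfies a relation `⋁ tₙ ≐ t` exactly when `p ↦ t_p^A`, with `t_∞ = t`, is ω-continuous on `ℕ∞`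
(`Relation.sat_iff`). Continuity in a parameter is what an enriched signature can demand of an
operation.

The theory `toEnriched` therefore keeps the operations and equations of `P` and adds, for each
relation, an operation with parameter object `ℕ∞` and the equations identifying its value at each
`p` with `t_p`. An operation obeying these equations exists if and only if the relation holds
(`Relation.toOp`, `withRelations.sat_reduct`), and it is then unique
(`withRelations.expansion_reduct`). Homomorphisms commute with terms (`Term.interp_naturality`), so
the added operations impose no new condition on them. Expansion and reduct are thus mutually inverse
and leave carriers and underlying maps unchanged. -/

noncomputable section

/-! ### Enriched functors into faithful targets -/

/-- Enriched functors that agree on objects are equal once they become equal after composition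
with a faithful enriched functor. -/
theorem CategoryTheory.EnrichedFunctor.eq_of_comp_eq {V : Type v} [Category.{w} V]
    [MonoidalCategory V] {C : Type u₁} {D : Type u₂} {E : Type u₃} [EnrichedCategory V C]
    [EnrichedCategory V D] [EnrichedCategory V E] {F G : EnrichedFunctor V C D}
    (W : EnrichedFunctor V D E) (hW : ∀ X Y, Mono (W.map X Y)) (hobj : ∀ X, F.obj X = G.obj X)
    (h : F.comp V W = G.comp V W) : F = G := by
  obtain ⟨f, mf, _, _⟩ := F
  obtain ⟨g, mg, _, _⟩ := G
  obtain rfl : f = g := funext hobj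
  have hmap : mf = mg := by
    -- With the object maps identified, the hom-maps have the same type, so the heterogeneous
    -- equality becomes one that faithfulness can cancel.
    have h' := (EnrichedFunctor.mk.inj h).2
    funext X Y
    exact (hW _ _).right_cancellation _ _ (congrFun (congrFun (eq_of_heq h') X) Y)
  subst hmap
  rfl

/-- An injective ω-continuous function is a monomorphism of ω-cpos. -/
theorem ωCPO.mono_of_injective {X Y : ωCPO.{u}} (f : X →𝒄 Y) (hf : Function.Injective f) :
    Mono (show X ⟶ Y from f) where
  right_cancellation {Z} g h e :=
    ContinuousHom.ext (α := Z) (β := X) g h fun z =>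
      hf (congrArg (fun k : Z →𝒄 Y => k z) e)

/-! ### Continuous functions on the extended natural numbers -/

section ENat

variable {β : Type*} [OmegaCompletePartialOrder β]

/-- A function on `ℕ∞` is ω-continuous iff its values at natural numbers form an ω-chain whose
supremum is its value at `⊤`. -/
theorem ωScottContinuous_enat_iff {g : ULift.{u} ℕ∞ → β} :
    ωScottContinuous g ↔ ∃ h : ∀ n : ℕ, g ⟨n⟩ ≤ g ⟨(n + 1 : ℕ)⟩,
      ωSup (⟨⟨fun n : ℕ => g ⟨n⟩, monotone_nat_of_le_succ h⟩⟩ : Chain β) = g ⟨⊤⟩ := by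
  constructor
  · intro hg
    have hle : ∀ m n : ℕ, m ≤ n → (⟨m⟩ : ULift.{u} ℕ∞) ≤ ⟨n⟩ := fun m n hmn =>
      ULift.up_le.2 (Nat.cast_le.2 hmn)
    refine ⟨fun n => hg.monotone (hle _ _ n.le_succ), ?_⟩
    let c : Chain (ULift.{u} ℕ∞) := ⟨⟨fun n : ℕ => ⟨n⟩, fun m n => hle m n⟩⟩
    have hc : ωSup c = ⟨⊤⟩ := by
      refine ULift.ext _ _ (ENat.eq_top_iff_forall_ge.2 fun n => ?_)
      exact le_ωSup c n
    rw [← hc]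
    exact (hg.map_ωSup c).symm
  · rintro ⟨h, hsup⟩
    have hmono : ∀ m n : ℕ, m ≤ n → g ⟨m⟩ ≤ g ⟨n⟩ := monotone_nat_of_le_succ h
    have htop : ∀ n : ℕ, g ⟨n⟩ ≤ g ⟨⊤⟩ := fun n => (le_ωSup (α := β) _ n).trans_eq hsup
    have hg : Monotone g := by
      rintro ⟨a⟩ ⟨b⟩ hab
      replace hab : a ≤ b := hab
      induction b using ENat.recTopCoe with
      | top =>
        induction a using ENat.recTopCoe with
        | top => exact le_rfl
        | coe m => exact htop m
      | coe n =>
        induction a using ENat.recTopCoe with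
        | top => exact absurd (top_le_iff.1 hab) (ENat.natCast_ne_top n)
        | coe m => exact hmono m n (Nat.cast_le.1 hab)
    refine .of_monotone_map_ωSup ⟨hg, fun c => le_antisymm ?_ ?_⟩
    -- If some term of the chain attains the supremum, monotonicity suffices.
    · by_cases hc : ∃ k, ωSup c ≤ c k
      · obtain ⟨k, hk⟩ := hc
        exact (hg hk).trans (le_ωSup (c.map ⟨g, hg⟩) k)
      · push Not at hc
        -- an unattained supremum forces arbitrarily large terms
        have hbig : ∀ m : ℕ, ∃ k, (⟨m⟩ : ULift.{u} ℕ∞) ≤ c k := by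
          intro m
          induction m with
          | zero => exact ⟨0, ULift.up_le.2 (by simp)⟩
          | succ m ih =>
            obtain ⟨k, hm⟩ := ih
            -- Otherwise, the order being linear, `c k` would bound the chain and hence its
            -- supremum, contrary to `hc`.
            have hj : ∃ j, c k < c j := by
              by_contra hj
              push Not at hj
              exact absurd (ωSup_le _ _ hj) (not_le_of_gt (hc k))
            obtain ⟨j, hj⟩ := hj
            have hlt : (m : ℕ∞) < (c j).down := lt_of_le_of_lt hm hj
            exact ⟨j, show ((m + 1 : ℕ) : ℕ∞) ≤ (c j).down from Order.add_one_le_of_lt hlt⟩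
        -- The value at `⊤` is the supremum of the values at naturals, and each of these lies below
        -- the value at some `c k`.
        refine (hg (show ωSup c ≤ ⟨⊤⟩ from le_top (a := (ωSup c).down))).trans ?_
        rw [← hsup]
        refine ωSup_le _ _ fun n => ?_
        obtain ⟨k, hk⟩ := hbig n
        exact (hg hk).trans (le_ωSup (c.map ⟨g, hg⟩) k)
    · exact ωSup_le _ _ fun k => hg (le_ωSup c k)

end ENat

/-! ### Contexts as arities -/

namespace Context

variable {S : Type u} (c : Context S)

instance (s : S) : Finite {n // (s, n) ∈ c} :=
  Finite.of_injective (fun n => (⟨(s, n.1), n.2⟩ : {x // x ∈ c}))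
    fun _ _ h => Subtype.ext (congrArg (fun x => x.1.2) h)

/-- The number of variables of each sort in a context. -/
def arity : S →₀ ℕ :=
  Finsupp.ofSupportFinite (fun s => Nat.card {n // (s, n) ∈ c}) <| by
    classical
    refine (c.image Prod.fst).finite_toSet.subset fun s hs => ?_
    obtain ⟨⟨n, hn⟩⟩ := (Nat.card_ne_zero.1 hs).1
    exact Finset.mem_coe.2 (Finset.mem_image.2 ⟨_, hn, rfl⟩)

/-- An enumeration of the variables of sort `s` in a context. -/
def varEquiv (s : S) : {n // (s, n) ∈ c} ≃ Fin (c.arity s) :=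
  Finite.equivFin _

variable {c} {X : Family S}

/-- Environments as elements of the power given by the arity of the context. -/
def envToPow (e : X.Env c) : X.Pow c.arity :=
  fun s i => e ⟨(s, (c.varEquiv s).symm i), ((c.varEquiv s).symm i).2⟩

/-- Elements of the power given by the arity of the context as environments. -/
def powToEnv (x : X.Pow c.arity) : X.Env c :=
  fun v => x v.1.1 (c.varEquiv v.1.1 ⟨v.1.2, v.2⟩)

theorem envToPow_powToEnv (x : X.Pow c.arity) : envToPow (powToEnv x) = x := by
  funext s i
  exact congrArg (x s) ((c.varEquiv s).apply_symm_apply i)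

theorem powToEnv_envToPow (e : X.Env c) : powToEnv (envToPow e) = e := by
  funext v
  -- Generalizing the variable at a fixed sort keeps the type of the value constant, so the equality
  -- can be substituted without transport.
  have h : ∀ n : {n // (v.1.1, n) ∈ c}, n = ⟨v.1.2, v.2⟩ →
      e ⟨(v.1.1, n.1), n.2⟩ = e v := by rintro _ rfl; rfl
  exact h _ ((c.varEquiv v.1.1).symm_apply_apply _)

theorem ωScottContinuous_envToPow : ωScottContinuous (envToPow (c := c) (X := X)) :=
  .of_apply₂ fun s => .of_apply₂ fun i =>
    ωScottContinuous.apply (β := fun x : {x // x ∈ c} => X x.1.1)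
      ⟨(s, (c.varEquiv s).symm i), ((c.varEquiv s).symm i).2⟩

theorem ωScottContinuous_powToEnv : ωScottContinuous (powToEnv (c := c) (X := X)) :=
  .of_apply₂ fun v =>
    (ωScottContinuous.apply (c.varEquiv v.1.1 ⟨v.1.2, v.2⟩)).comp (ωScottContinuous.apply v.1.1)

end Context

/-! ### Terms and relations -/

namespace ClassicalSignature

variable {S : Type u} {Sig : ClassicalSignature S}

/-- The interpretation of terms is natural with respect to homomorphisms of algebras. -/
theorem Term.interp_naturality {A B : Sig.Algebra} {f : ∀ s, A.carrier s →𝒄 B.carrier s}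
    (hf : EnrichedSignature.IsHom A B f) {c : Context S} {s : S} (t : Sig.Term c s)
    (e : A.carrier.Env c) :
    f s (t.interp A e) = t.interp B fun v => f v.1.1 (e v) := by
  induction t with
  | var s n h => rfl
  | op σ t ih =>
    refine (hf σ PUnit.unit _).trans (congrArg (B.ordOp σ) ?_)
    funext s i
    exact ih s i

/-- The terms occurring in a relation, as a family indexed by `ℕ∞`. -/
def Relation.term (r : Sig.Relation) (p : ULift.{u} ℕ∞) : Sig.Term r.ctx r.sort :=
  ENat.recTopCoe r.sup r.seq p.down

/-- An algebra satisfies a relation iff the interpretations of its terms depend continuously on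
their index in `ℕ∞`. -/
theorem Relation.sat_iff (r : Sig.Relation) (A : Sig.Algebra) :
    r.Sat A ↔ ωScottContinuous fun p => (r.term p).interp A :=
  (ωScottContinuous_enat_iff (g := fun p => (r.term p).interp A)).symm

end ClassicalSignature

/-! ### Relations as parametrized operations -/

namespace ClassicalSignature

variable {S : Type u} {Sig : ClassicalSignature S} {R : Set Sig.Relation}

variable (R) in
/-- The extension of a classical signature by an operation with parameter object `ℕ∞` for each
relation in a given set. -/
def withRelations : EnrichedSignature S where
  Op := Sig.Op ⊕ R
  input := Sum.elim Sig.input fun r => r.1.ctx.arity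
  output := Sum.elim Sig.output fun r => r.1.sort
  param := Sum.elim (fun _ => 𝟙_ ωCPO.{u}) fun _ => ωCPO.of (ULift.{u} ℕ∞)

/-- The algebra obtained by forgetting the operations given by relations. -/
def withRelations.reduct (A : (withRelations R).Algebra) : Sig.Algebra where
  carrier := A.carrier
  op σ := A.op (.inl σ)

/-- The operation of an algebra satisfying a relation that is given by the terms of the
relation. -/
def Relation.toOp (r : Sig.Relation) {A : Sig.Algebra} (h : r.Sat A) :
    ULift.{u} ℕ∞ →𝒄 (A.carrier.Pow r.ctx.arity →𝒄 A.carrier r.sort) :=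
  .ofFun (fun p => ((r.term p).interp A).comp
      (.ofFun Context.powToEnv Context.ωScottContinuous_powToEnv))
    -- Continuity in `p` at each fixed `x` is where satisfaction of the relation enters.
    (ωScottContinuous_of_pointwise fun x =>
      (ωScottContinuous_eval (Context.powToEnv x)).comp ((r.sat_iff A).1 h))

/-- The extension of an algebra satisfying relations by the operations given by these. -/
def withRelations.expansion (A : Sig.Algebra) (h : ∀ r ∈ R, r.Sat A) :
    (withRelations R).Algebra where
  carrier := A.carrier
  op
    | .inl σ => A.op σ
    | .inr r => r.1.toOp (h r.1 r.2)

variable (R) in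
/-- Terms as terms over the extended signature. -/
def Term.lift {c : Context S} : {s : S} → Sig.Term c s → (withRelations R).underlying.Term c s
  | _, .var s n h => .var s n h
  | _, .op σ t => .op (Sig := (withRelations R).underlying) ⟨.inl σ, PUnit.unit⟩
      fun s i => (t s i).lift

theorem Term.interp_lift (A : (withRelations R).Algebra) {c : Context S} {s : S}
    (t : Sig.Term c s) :
    (t.lift R).interp A.underlying = t.interp (withRelations.reduct A) := by
  induction t with
  | var s n h => rfl
  | op σ t ih =>
    refine ContinuousHom.ext _ _ fun e => congrArg ((withRelations.reduct A).ordOp σ) ?_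
    funext s i
    exact congrArg (fun f : A.carrier.Env c →𝒄 A.carrier s => f e) (ih s i)

variable (R) in
/-- Equations as equations over the extended signature. -/
def Equation.lift (e : Sig.Equation) : (withRelations R).underlying.Equation where
  ctx := e.ctx
  sort := e.sort
  lhs := e.lhs.lift R
  rhs := e.rhs.lift R

theorem Equation.lift_sat_iff (A : (withRelations R).Algebra) (e : Sig.Equation) :
    (e.lift R).Sat A.underlying ↔ e.Sat (withRelations.reduct A) := by
  unfold Equation.Sat
  exact (congrArg₂ Eq (Term.interp_lift A e.lhs) (Term.interp_lift A e.rhs)).to_iff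

/-- The operation given by a relation, at a parameter and applied to the variables of the context
of the relation. -/
def Relation.opTerm (r : R) (p : ULift.{u} ℕ∞) :
    (withRelations R).underlying.Term r.1.ctx r.1.sort :=
  .op (Sig := (withRelations R).underlying) ⟨.inr r, p⟩ fun s i =>
    .var s ((r.1.ctx.varEquiv s).symm i) ((r.1.ctx.varEquiv s).symm i).2

/-- The equation that defines the operation given by a relation, at a parameter. -/
def Relation.opEquation (r : R) (p : ULift.{u} ℕ∞) : (withRelations R).underlying.Equation where
  ctx := r.1.ctx
  sort := r.1.sort
  lhs := Relation.opTerm r p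
  rhs := (r.1.term p).lift R

/-- The arguments in `opTerm` are the variables in the order of `varEquiv`, so in an environment `e`
they evaluate to `envToPow e`. -/
theorem Relation.opEquation_sat_iff (A : (withRelations R).Algebra) (r : R)
    (p : ULift.{u} ℕ∞) :
    (Relation.opEquation r p).Sat A.underlying ↔ ∀ e : A.carrier.Env r.1.ctx,
      A.op (.inr r) p (Context.envToPow e) = (r.1.term p).interp (withRelations.reduct A) e := by
  rw [← Term.interp_lift]
  exact ⟨fun h e => congrArg (fun f : A.carrier.Env r.1.ctx →𝒄 A.carrier r.1.sort => f e) h,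
    fun h => ContinuousHom.ext _ _ h⟩

/-- The added operations are interpreted by terms, with which every homomorphism already commutes.
-/
theorem withRelations.isHom_expansion {A B : Sig.Algebra} (hA : ∀ r ∈ R, r.Sat A)
    (hB : ∀ r ∈ R, r.Sat B) {f : ∀ s, A.carrier s →𝒄 B.carrier s}
    (hf : EnrichedSignature.IsHom A B f) :
    EnrichedSignature.IsHom (expansion A hA) (expansion B hB) f
  | .inl σ, p, x => hf σ p x
  | .inr r, p, x => Term.interp_naturality hf (r.1.term p) (Context.powToEnv x)

theorem withRelations.isHom_reduct {A B : (withRelations R).Algebra}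
    {f : ∀ s, A.carrier s →𝒄 B.carrier s} (hf : EnrichedSignature.IsHom A B f) :
    EnrichedSignature.IsHom (reduct A) (reduct B) f :=
  fun σ p x => hf (.inl σ) p x

/-- The added operation is ω-continuous in its parameter by definition of an algebra, and the
equations transfer this continuity to the terms. -/
theorem withRelations.sat_reduct (A : (withRelations R).Algebra) (r : R)
    (h : ∀ p, (Relation.opEquation r p).Sat A.underlying) : r.1.Sat (reduct A) := by
  refine (r.1.sat_iff _).2 (ωScottContinuous_of_pointwise fun e => ?_)
  have hc : ωScottContinuous fun p : ULift.{u} ℕ∞ => A.op (.inr r) p (Context.envToPow e) :=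
    (ωScottContinuous_eval (Context.envToPow e)).comp (A.op (.inr r)).ωScottContinuous
  exact (funext fun p => (Relation.opEquation_sat_iff A r p).1 (h p) e) ▸ hc

/-- The defining equations leave no freedom in the added operations, since every element of the
power comes from an environment. -/
theorem withRelations.expansion_reduct (A : (withRelations R).Algebra)
    (h : ∀ (r : R) p, (Relation.opEquation r p).Sat A.underlying)
    (h' : ∀ r ∈ R, r.Sat (reduct A)) : expansion (reduct A) h' = A := by
  obtain ⟨carrier, op⟩ := A
  refine congrArg (EnrichedSignature.Algebra.mk carrier) (funext fun σ => ?_)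
  match σ with
  | .inl σ => rfl
  | .inr r =>
    refine ContinuousHom.ext _ _ fun p => ContinuousHom.ext _ _ fun x => ?_
    refine ((Relation.opEquation_sat_iff _ r p).1 (h r p) (Context.powToEnv x)).symm.trans ?_
    exact congrArg (op (.inr r) p) (Context.envToPow_powToEnv x)

end ClassicalSignature

/-! ### The enriched theory of a classical theory with relations -/

namespace ClassicalTheoryWithRelations

open ClassicalSignature

variable {S : Type u} (P : ClassicalTheoryWithRelations S)

/-- The enriched theory that has the operations and equations of `P` together with, for each
relation, an operation with parameter object `ℕ∞` defined by the terms of the relation. -/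
def toEnriched : EnrichedTheory S where
  sig := withRelations P.rels
  eqns := Equation.lift P.rels '' P.eqns ∪
    Set.range fun x : P.rels × ULift.{u} ℕ∞ => Relation.opEquation x.1 x.2

variable {P}

theorem opEquation_sat {A : (withRelations P.rels).Algebra} (h : P.toEnriched.IsAlgebra A)
    (r : P.rels) (p : ULift.{u} ℕ∞) : (Relation.opEquation r p).Sat A.underlying :=
  h _ (.inr ⟨(r, p), rfl⟩)

theorem isAlgebra_reduct {A : (withRelations P.rels).Algebra} (h : P.toEnriched.IsAlgebra A) :
    P.IsAlgebra (withRelations.reduct A) :=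
  ⟨fun r hr => withRelations.sat_reduct A ⟨r, hr⟩ (opEquation_sat h ⟨r, hr⟩),
    fun e he => (Equation.lift_sat_iff A e).1 (h _ (.inl ⟨e, he, rfl⟩))⟩

theorem isAlgebra_expansion {A : P.sig.Algebra} (h : P.IsAlgebra A) :
    P.toEnriched.IsAlgebra (withRelations.expansion A h.1) := by
  rintro _ (⟨e, he, rfl⟩ | ⟨⟨r, p⟩, rfl⟩)
  · exact (Equation.lift_sat_iff _ e).2 (h.2 e he)
  -- The added operation is by construction the term precomposed with `powToEnv`, so only the round
  -- trip on `e` remains.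
  · exact (Relation.opEquation_sat_iff _ r p).2 fun e =>
      congrArg ((r.1.term p).interp A) (Context.powToEnv_envToPow e)

variable (P)

/-- The enriched functor that adds the operations given by the relations. -/
def expansionFunctor : EnrichedFunctor ωCPO.{u} P.Alg P.toEnriched.Alg where
  obj A := ⟨withRelations.expansion A.obj A.property.1, isAlgebra_expansion A.property⟩
  map A B := (ContinuousHom.ofFun
    (fun f => ⟨f.1, withRelations.isHom_expansion A.property.1 B.property.1 f.2⟩)
    (.of_monotone_map_ωSup ⟨fun _ _ h => h, fun _ => rfl⟩) :
    {f // EnrichedSignature.IsHom A.obj B.obj f} →𝒄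
      {f // EnrichedSignature.IsHom (withRelations.expansion A.obj A.property.1)
        (withRelations.expansion B.obj B.property.1) f})
  map_id _ := rfl
  map_comp _ _ _ := rfl

/-- The enriched functor that forgets the operations given by the relations. -/
def reductFunctor : EnrichedFunctor ωCPO.{u} P.toEnriched.Alg P.Alg where
  obj A := ⟨withRelations.reduct A.obj, isAlgebra_reduct A.property⟩
  map A B := (ContinuousHom.ofFun
    (fun f => ⟨f.1, withRelations.isHom_reduct f.2⟩)
    (.of_monotone_map_ωSup ⟨fun _ _ h => h, fun _ => rfl⟩) :
    {f // EnrichedSignature.IsHom A.obj B.obj f} →𝒄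
      {f // EnrichedSignature.IsHom (withRelations.reduct A.obj) (withRelations.reduct B.obj) f})
  map_id _ := rfl
  map_comp _ _ _ := rfl

end ClassicalTheoryWithRelations

/-- The forgetful enriched functor on the algebras of an enriched theory is faithful. -/
theorem EnrichedTheory.forget_mono {S : Type u} (T : EnrichedTheory S) (A B : T.Alg) :
    Mono (T.forget.map A B) :=
  ωCPO.mono_of_injective
    (X := ωCPO.of {f // EnrichedSignature.IsHom A.obj B.obj f})
    (Y := ωCPO.of (∀ s, A.obj.carrier s →𝒄 B.obj.carrier s))
    (ContinuousHom.ofFun Subtype.val (EnrichedSignature.ωScottContinuous_val A.obj B.obj))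
    Subtype.val_injective

end

theorem mainTheorem9 {S : Type u} (P : ClassicalTheoryWithRelations S) :
    ∃ T : EnrichedTheory S, IsoOver ωCPO.{u} P.forget T.forget := by
  -- Expanding and then forgetting is definitionally the identity; the other composite recovers the
  -- added operations only through their equations.
  refine ⟨P.toEnriched, P.expansionFunctor, P.reductFunctor, rfl, ?_, rfl, rfl⟩
  -- Cancelling the faithful forgetful functor reduces the claim to objects and avoids transporting
  -- hom-maps along equalities of algebras.
  refine EnrichedFunctor.eq_of_comp_eq P.toEnriched.forget P.toEnriched.forget_mono ?_ rfl
  rintro ⟨A, hA⟩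
  have h := ClassicalSignature.withRelations.expansion_reduct A
    (ClassicalTheoryWithRelations.opEquation_sat hA)
    (ClassicalTheoryWithRelations.isAlgebra_reduct hA).1
  exact (FullSub.mk.injEq ..).mpr h
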